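/- Let $d\ge 1$, $0<T<\infty$ and $1<\alpha<2$, and let $L=(L(t))_{0\le t\le T}$ be an isotropic $\alpha$-stable Lévy process in $\mathbb{R}^d$ on a probability space $(\Omega,\mathcal F,\mathbb P)$; that is, $L$ starts at $0$, has independent stationary increments and almost surely càdlàg paths, and for some constant $c>0$, $\mathbb{E}\,e^{i\langle L(t),h\rangle}=e^{-ct|h|^\alpha}$ for all $h\in\mathbb{R}^d$ and $0\le t\le T$. For $\varepsilon>0$ the Ornstein--Uhlenbeck process $$Z^\varepsilon(t)=\int_0^t e^{-\varepsilon^{-1}(t-s)}\,dL(s),\qquad 0\le t\le T,$$ where the stochastic integral is the limit in probability of the left-endpoint Riemann sums as the mesh of the partition of $[0,t]$ tends to $0$, exists and has a càdlàg version. A càdlàg process is a version of $Z^\varepsilon$ if and only if it solves $$dZ^\varepsilon(t)=-\varepsilon^{-1}Z^\varepsilon(t)\,dt+dL(t),\qquad Z^\varepsilon(0)=0,$$ that is, if and only if almost surely $Z^\varepsilon(0)=0$ and $Z^\varepsilon(t)=-\varepsilon^{-1}\int_0^t Z^\varepsilon(s)\,ds+L(t)$ for all $0\le t\le T$. For any càdlàg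 versions $Z^\varepsilon$, $\varepsilon>0$, $$\limsup_{\varepsilon\downarrow0}\ \mathbb{E}\sup_{0\le t\le T}|Z^\varepsilon(t)|>0,$$ although $\lim_{\varepsilon\downarrow0}\mathbb{E}|Z^\varepsilon(t)|=0$ for every fixed $t\in[0,T]$. (Expectations take values in $[0,\infty]$.) -/

import Mathlib

open MeasureTheory ProbabilityTheory Filter Set
open scoped Topology ENNReal

/-- `x` restricted to `[0, T]` is càdlàg: right-continuous with left limits. -/
def IsCadlagOn {E : Type*} [TopologicalSpace E] (T : ℝ) (x : ℝ → E) : Prop :=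
  ∀ t ∈ Icc 0 T, ContinuousWithinAt x (Icc t T) t ∧ ∃ l, Tendsto x (𝓝[Ico 0 t] t) (𝓝 l)

/-- `L` is an `E`-valued Lévy process on the time interval `[0, T]` under `P`: it starts at `0`,
has independent and stationary increments, and almost surely has càdlàg paths (stochastic
continuity is then automatic). The values of `L` at times outside `[0, T]` play no role. -/
structure IsLevyProcessOn {Ω E : Type*} [MeasurableSpace Ω] [NormedAddCommGroup E]
    [MeasurableSpace E] (P : Measure Ω) (T : ℝ) (L : ℝ → Ω → E) : Prop where
  aemeasurable : ∀ t ∈ Icc 0 T, AEMeasurable (L t) P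
  zero : ∀ᵐ ω ∂P, L 0 ω = 0
  indep : HasIndepIncrements (fun t : Icc (0 : ℝ) T => L t) P
  stationary : ∀ s t, 0 ≤ s → s ≤ t → t ≤ T → IdentDistrib (L t - L s) (L (t - s)) P P
  cadlag : ∀ᵐ ω ∂P, IsCadlagOn T (fun t => L t ω)

/-- `L` is an isotropic `α`-stable Lévy process on `[0, T]`:
`𝔼 exp(i ⟨L(t), h⟩) = exp(-c t |h| ^ α)` for some constant `c > 0`. -/
structure IsIsotropicStableOn {Ω E : Type*} [MeasurableSpace Ω] [NormedAddCommGroup E]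
    [InnerProductSpace ℝ E] [MeasurableSpace E] (P : Measure Ω) (T α : ℝ)
    (L : ℝ → Ω → E) : Prop extends IsLevyProcessOn P T L where
  charFun_eq : ∃ c : ℝ, 0 < c ∧ ∀ t ∈ Icc 0 T, ∀ h : E,
    charFun (P.map (L t)) h = (Real.exp (-(c * t * ‖h‖ ^ α)) : ℂ)

/-- A finite partition `0 = p 0 ≤ p 1 ≤ ⋯ ≤ p n = t` of `[0, t]`. -/
structure TimePartition (t : ℝ) where
  n : ℕ
  p : ℕ → ℝ
  mono : Monotone p
  first : p 0 = 0
  last : p n = t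

/-- The length of the longest interval of a partition. -/
noncomputable def TimePartition.mesh {t : ℝ} (π : TimePartition t) : ℝ :=
  ⨆ i : Fin π.n, (π.p (i + 1) - π.p i)

/-- The left-endpoint sum `∑ᵢ f(pᵢ) (L(pᵢ₊₁) - L(pᵢ))`. -/
noncomputable def TimePartition.sum {Ω E : Type*} [NormedAddCommGroup E] [NormedSpace ℝ E]
    {t : ℝ} (π : TimePartition t) (f : ℝ → ℝ) (L : ℝ → Ω → E) (ω : Ω) : E :=
  ∑ i ∈ Finset.range π.n, f (π.p i) • (L (π.p (i + 1)) ω - L (π.p i) ω)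

/-- `X = ∫₀ᵗ f(s) dL(s)`, for a continuous deterministic integrand `f`: the stochastic integral is
the limit in probability of the left-endpoint sums as the mesh of the partition tends to `0`. -/
def IsStochasticIntegral {Ω E : Type*} [MeasurableSpace Ω] [NormedAddCommGroup E]
    [NormedSpace ℝ E] [MeasurableSpace E] (P : Measure Ω) (f : ℝ → ℝ) (L : ℝ → Ω → E) (t : ℝ)
    (X : Ω → E) : Prop :=
  AEMeasurable X P ∧
    TendstoInMeasure P (fun π : TimePartition t => π.sum f L)
      (comap TimePartition.mesh (𝓝 0)) X

/-- `Z` is a càdlàg version on `[0, T]` of the process `Z(t) = ∫₀ᵗ exp(-ε⁻¹ (t - s)) dL(s)`. -/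
structure IsOUIntegral {Ω E : Type*} [MeasurableSpace Ω] [NormedAddCommGroup E]
    [NormedSpace ℝ E] [MeasurableSpace E] (P : Measure Ω) (T ε : ℝ) (L Z : ℝ → Ω → E) :
    Prop where
  cadlag : ∀ᵐ ω ∂P, IsCadlagOn T (fun t => Z t ω)
  eq_integral : ∀ t ∈ Icc 0 T,
    IsStochasticIntegral P (fun s => Real.exp (-(ε⁻¹ * (t - s)))) L t (Z t)

/-- `Z` is a càdlàg solution on `[0, T]` of `dZ = -ε⁻¹ Z dt + dL`, `Z(0) = 0`, that is, almost
surely `Z(0) = 0` and `Z(t) = -ε⁻¹ ∫₀ᵗ Z(s) ds + (L(t) - L(0))` for all `t ∈ [0, T]`. -/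
structure SolvesOU {Ω E : Type*} [MeasurableSpace Ω] [NormedAddCommGroup E]
    [NormedSpace ℝ E] [MeasurableSpace E] (P : Measure Ω) (T ε : ℝ) (L Z : ℝ → Ω → E) :
    Prop where
  aemeasurable : ∀ t ∈ Icc 0 T, AEMeasurable (Z t) P
  cadlag : ∀ᵐ ω ∂P, IsCadlagOn T (fun t => Z t ω)
  init : ∀ᵐ ω ∂P, Z 0 ω = 0
  eq : ∀ᵐ ω ∂P, ∀ t ∈ Icc 0 T,
    Z t ω = -(ε⁻¹ • ∫ s in (0 : ℝ)..t, Z s ω) + (L t ω - L 0 ω)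

theorem IsCadlagOn.exists_norm_le {E : Type*} [NormedAddCommGroup E] {T : ℝ} {x : ℝ → E}
    (hx : IsCadlagOn T x) : ∃ C, 0 ≤ C ∧ ∀ t ∈ Icc 0 T, ‖x t‖ ≤ C := by
  suffices h : ∃ C, ∀ t ∈ Icc 0 T, ‖x t‖ ≤ C by
    obtain ⟨C, hC⟩ := h
    exact ⟨max C 0, le_max_right _ _, fun t ht => (hC t ht).trans (le_max_left _ _)⟩
  refine isCompact_Icc.induction_on (p := fun s => ∃ C, ∀ t ∈ s, ‖x t‖ ≤ C) ?_ ?_ ?_ ?_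
  · exact ⟨0, by simp⟩
  · rintro s t hst ⟨C, hC⟩
    exact ⟨C, fun u hu => hC u (hst hu)⟩
  · rintro s t ⟨C, hC⟩ ⟨D, hD⟩
    refine ⟨max C D, ?_⟩
    rintro u (hu | hu)
    · exact (hC u hu).trans (le_max_left _ _)
    · exact (hD u hu).trans (le_max_right _ _)
  · intro t ht
    obtain ⟨h1, l, h2⟩ := hx t ht
    have e1 : ∀ᶠ s in 𝓝[Icc t T] t, ‖x s‖ < ‖x t‖ + 1 :=
      (h1.norm : Tendsto _ _ _).eventually_lt_const (by linarith)
    have e2 : ∀ᶠ s in 𝓝[Ico 0 t] t, ‖x s‖ < ‖l‖ + 1 :=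
      h2.norm.eventually_lt_const (by linarith)
    have hU : Icc 0 T = Ico 0 t ∪ Icc t T := by
      ext s
      have := ht.1
      have := ht.2
      simp only [mem_Icc, mem_union, mem_Ico]
      grind
    have e3 : ∀ᶠ s in 𝓝[Icc 0 T] t, ‖x s‖ ≤ max (‖x t‖ + 1) (‖l‖ + 1) := by
      rw [hU, nhdsWithin_union, eventually_sup]
      exact ⟨e2.mono fun s hs => hs.le.trans (le_max_right _ _),
        e1.mono fun s hs => hs.le.trans (le_max_left _ _)⟩
    exact ⟨_, e3, _, fun s hs => hs⟩

theorem IsCadlagOn.sub {E : Type*} [NormedAddCommGroup E] {T : ℝ} {x y : ℝ → E}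
    (hx : IsCadlagOn T x) (hy : IsCadlagOn T y) : IsCadlagOn T (fun t => x t - y t) := by
  intro t ht
  obtain ⟨h1, l, h2⟩ := hx t ht
  obtain ⟨h3, m, h4⟩ := hy t ht
  exact ⟨h1.sub h3, l - m, h2.sub h4⟩

theorem ContinuousOn.isCadlagOn {E : Type*} [TopologicalSpace E] {T : ℝ} {x : ℝ → E}
    (hx : ContinuousOn x (Icc 0 T)) : IsCadlagOn T x := by
  intro t ht
  refine ⟨(hx t ht).mono (Icc_subset_Icc_left ht.1), x t, (hx t ht).mono ?_⟩
  exact fun s hs => ⟨hs.1, hs.2.le.trans ht.2⟩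

theorem IsCadlagOn.mono {E : Type*} [TopologicalSpace E] {T t : ℝ} {x : ℝ → E}
    (hx : IsCadlagOn T x) (ht : t ≤ T) : IsCadlagOn t x := fun s hs =>
  ⟨(hx s ⟨hs.1, hs.2.trans ht⟩).1.mono (Icc_subset_Icc_right ht), (hx s ⟨hs.1, hs.2.trans ht⟩).2⟩

/-- A càdlàg function is the pointwise limit of its discretisations from the right. -/
theorem IsCadlagOn.aestronglyMeasurable {E : Type*} [NormedAddCommGroup E] {T : ℝ} {x : ℝ → E}
    (hx : IsCadlagOn T x) : AEStronglyMeasurable x (volume.restrict (Icc 0 T)) := by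
  rw [← restrict_Ico_eq_restrict_Icc]
  set g : ℕ → ℝ → ℝ := fun n s => min T ((⌊(n + 1 : ℝ) * s⌋ + 1) / (n + 1)) with hg
  refine aestronglyMeasurable_of_tendsto_ae atTop (f := fun n s => x (g n s)) (fun n => ?_) ?_
  · have h : Measurable fun s : ℝ => ⌊(n + 1 : ℝ) * s⌋ := by fun_prop
    have h2 : StronglyMeasurable fun k : ℤ => x (min T ((k + 1) / (n + 1))) :=
      StronglyMeasurable.of_discrete
    exact (h2.comp_measurable h).aestronglyMeasurable
  · refine (ae_restrict_iff' measurableSet_Ico).2 (ae_of_all _ fun s hs => ?_)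
    have hc := (hx s ⟨hs.1, hs.2.le⟩).1
    have hlow : ∀ n, s ≤ g n s := fun n => by
      refine le_min hs.2.le ?_
      rw [le_div_iff₀ (by positivity)]
      linarith [Int.lt_floor_add_one ((n + 1 : ℝ) * s)]
    have hup : ∀ n, g n s ≤ s + 1 / (n + 1) := fun n => by
      refine (min_le_right _ _).trans ?_
      rw [div_le_iff₀ (by positivity)]
      have : (s + 1 / (n + 1 : ℝ)) * (n + 1) = (n + 1) * s + 1 := by field_simp
      linarith [Int.floor_le ((n + 1 : ℝ) * s)]
    have ht : Tendsto (fun n => g n s) atTop (𝓝 s) := by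
      refine tendsto_of_tendsto_of_tendsto_of_le_of_le tendsto_const_nhds ?_ hlow hup
      simpa using tendsto_const_nhds.add (tendsto_one_div_add_atTop_nhds_zero_nat (𝕜 := ℝ))
    refine hc.tendsto.comp (tendsto_nhdsWithin_iff.2 ⟨ht, Eventually.of_forall fun n => ?_⟩)
    exact ⟨hlow n, min_le_left _ _⟩

theorem IsCadlagOn.integrableOn {E : Type*} [NormedAddCommGroup E] {T : ℝ} {x : ℝ → E}
    (hx : IsCadlagOn T x) : IntegrableOn x (Icc 0 T) := by
  obtain ⟨C, -, hC⟩ := hx.exists_norm_le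
  exact IntegrableOn.of_bound (by simp) hx.aestronglyMeasurable C
    ((ae_restrict_iff' measurableSet_Icc).2 (ae_of_all _ hC))

theorem IsCadlagOn.smul {E : Type*} [NormedAddCommGroup E] [NormedSpace ℝ E] {T : ℝ} {x : ℝ → E}
    (hx : IsCadlagOn T x) {f : ℝ → ℝ} (hf : Continuous f) :
    IsCadlagOn T (fun t => f t • x t) := by
  intro t ht
  obtain ⟨h1, l, h2⟩ := hx t ht
  exact ⟨hf.continuousWithinAt.smul h1, f t • l, (hf.continuousWithinAt.tendsto).smul h2⟩

theorem IsCadlagOn.intervalIntegrable {E : Type*} [NormedAddCommGroup E] {T t : ℝ} {x : ℝ → E}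
    (hx : IsCadlagOn T x) (ht : t ∈ Icc 0 T) : IntervalIntegrable x volume 0 t :=
  (intervalIntegrable_iff_integrableOn_Icc_of_le ht.1).2
    (hx.integrableOn.mono_set (Icc_subset_Icc_right ht.2))

theorem IsCadlagOn.continuousOn_primitive {E : Type*} [NormedAddCommGroup E] [NormedSpace ℝ E]
    {T : ℝ} {x : ℝ → E} (hT : 0 ≤ T) (hx : IsCadlagOn T x) :
    ContinuousOn (fun t => ∫ s in (0 : ℝ)..t, x s) (Icc 0 T) := by
  have := intervalIntegral.continuousOn_primitive_interval (μ := volume) (f := x) (a := 0) (b := T)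
    (by rw [uIcc_of_le hT]; exact hx.integrableOn)
  rwa [uIcc_of_le hT] at this

theorem IsCadlagOn.hasDerivWithinAt_primitive {E : Type*} [NormedAddCommGroup E]
    [NormedSpace ℝ E] [CompleteSpace E] {T t : ℝ} {x : ℝ → E} (hx : IsCadlagOn T x)
    (ht : t ∈ Ioo 0 T) :
    HasDerivWithinAt (fun t => ∫ s in (0 : ℝ)..t, x s) (x t) (Ioi t) t := by
  have ht' : t ∈ Icc 0 T := Ioo_subset_Icc_self ht
  refine (intervalIntegral.integral_hasDerivWithinAt_right (hx.intervalIntegrable ht')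
    (s := Ici t) (t := Ioi t) ?_ ?_).mono Ioi_subset_Ici_self
  · have h : Ioc t T ⊆ Icc 0 T := fun s hs => ⟨ht.1.le.trans hs.1.le, hs.2⟩
    exact ⟨Ioc t T, Ioc_mem_nhdsGT ht.2, hx.aestronglyMeasurable.mono_measure
      (Measure.restrict_mono h le_rfl)⟩
  · exact (hx t ht').1.mono_of_mem_nhdsWithin
      (mem_of_superset (Ioc_mem_nhdsGT ht.2) Ioc_subset_Icc_self)

/-- The Ornstein–Uhlenbeck transform `x(t) - ∫₀ᵗ a exp(-a (t - s)) x(s) ds` of a path. -/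
noncomputable def ouPath {E : Type*} [NormedAddCommGroup E] [NormedSpace ℝ E] (a : ℝ)
    (x : ℝ → E) (t : ℝ) : E :=
  x t - (a * Real.exp (-(a * t))) • ∫ s in (0 : ℝ)..t, Real.exp (a * s) • x s

theorem IsCadlagOn.ouPath {E : Type*} [NormedAddCommGroup E] [NormedSpace ℝ E] {T : ℝ}
    {x : ℝ → E} (hT : 0 ≤ T) (hx : IsCadlagOn T x) (a : ℝ) : IsCadlagOn T (ouPath a x) := by
  refine hx.sub (ContinuousOn.isCadlagOn ?_)
  exact (by fun_prop : ContinuousOn (fun t => a * Real.exp (-(a * t))) (Icc 0 T)).smul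
    ((hx.smul (by fun_prop : Continuous fun s => Real.exp (a * s))).continuousOn_primitive hT)

theorem ouPath_eq {E : Type*} [NormedAddCommGroup E] [NormedSpace ℝ E] [CompleteSpace E] {T a : ℝ}
    {x : ℝ → E} (hx : IsCadlagOn T x) {t : ℝ} (ht : t ∈ Icc 0 T) :
    ouPath a x t = -(a • ∫ s in (0 : ℝ)..t, ouPath a x s) + x t := by
  have hT : 0 ≤ T := ht.1.trans ht.2
  have hG := hx.smul (by fun_prop : Continuous fun s => Real.exp (a * s))
  have hsub : Icc 0 t ⊆ Icc 0 T := Icc_subset_Icc_right ht.2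
  have key := intervalIntegral.integral_eq_sub_of_hasDeriv_right (a := 0) (b := t)
    (f := fun t => Real.exp (-(a * t)) • ∫ s in (0 : ℝ)..t, Real.exp (a * s) • x s)
    (f' := ouPath a x) ?_ ?_ ((hx.ouPath hT a).intervalIntegrable ht)
  · rw [key]
    simp [ouPath, smul_smul]
    abel
  · rw [uIcc_of_le ht.1]
    exact (by fun_prop : ContinuousOn (fun t => Real.exp (-(a * t))) (Icc 0 t)).smul
      ((hG.continuousOn_primitive hT).mono hsub)
  · intro s hs
    rw [min_eq_left ht.1, max_eq_right ht.1] at hs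
    have h1 := hG.hasDerivWithinAt_primitive ⟨hs.1, hs.2.trans_le ht.2⟩
    have h2 : HasDerivWithinAt (fun s => Real.exp (-(a * s))) (Real.exp (-(a * s)) * (-a))
        (Ioi s) s := by
      have : HasDerivAt (fun s => -(a * s)) (-a) s := by
        simpa using (hasDerivAt_id s).const_mul (-a)
      exact this.exp.hasDerivWithinAt
    refine (h2.smul h1).congr_deriv ?_
    rw [smul_smul, ← Real.exp_add]
    simp only [ouPath, neg_add_cancel, Real.exp_zero, one_smul, mul_neg, neg_smul, mul_comm a]
    abel

theorem eq_ouPath {E : Type*} [NormedAddCommGroup E] [NormedSpace ℝ E] [CompleteSpace E] {T a : ℝ}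
    {x z : ℝ → E} (hx : IsCadlagOn T x) (hz : IsCadlagOn T z)
    (h : ∀ t ∈ Icc 0 T, z t = -(a • ∫ s in (0 : ℝ)..t, z s) + x t) {t : ℝ} (ht : t ∈ Icc 0 T) :
    z t = ouPath a x t := by
  have hT : 0 ≤ T := ht.1.trans ht.2
  have hG := hx.smul (by fun_prop : Continuous fun s => Real.exp (a * s))
  have hsub : Icc 0 t ⊆ Icc 0 T := Icc_subset_Icc_right ht.2
  have key := intervalIntegral.integral_eq_sub_of_hasDeriv_right (a := 0) (b := t)
    (f := fun t => Real.exp (a * t) • ∫ s in (0 : ℝ)..t, z s)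
    (f' := fun s => Real.exp (a * s) • x s) ?_ ?_ (hG.intervalIntegrable ht)
  · rw [ouPath, key, h t ht]
    have : a * Real.exp (-(a * t)) * Real.exp (a * t) = a := by
      rw [mul_assoc, ← Real.exp_add]; simp
    simp only [intervalIntegral.integral_same, smul_zero, sub_zero, smul_smul, this]
    abel
  · rw [uIcc_of_le ht.1]
    exact (by fun_prop : ContinuousOn (fun t => Real.exp (a * t)) (Icc 0 t)).smul
      ((hz.continuousOn_primitive hT).mono hsub)
  · intro s hs
    rw [min_eq_left ht.1, max_eq_right ht.1] at hs
    have h1 := hz.hasDerivWithinAt_primitive ⟨hs.1, hs.2.trans_le ht.2⟩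
    have h2 : HasDerivWithinAt (fun s => Real.exp (a * s)) (Real.exp (a * s) * a)
        (Ioi s) s := by
      have : HasDerivAt (fun s => a * s) a s := by
        simpa using (hasDerivAt_id s).const_mul a
      exact this.exp.hasDerivWithinAt
    refine (h2.smul h1).congr_deriv ?_
    rw [h s ⟨hs.1.le, hs.2.le.trans ht.2⟩, smul_add, smul_neg, smul_smul]
    abel

namespace TimePartition

theorem le_mesh {t : ℝ} (π : TimePartition t) {i : ℕ} (hi : i < π.n) :
    π.p (i + 1) - π.p i ≤ π.mesh :=
  le_ciSup (f := fun i : Fin π.n => π.p (i + 1) - π.p i) (finite_range _).bddAbove ⟨i, hi⟩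

theorem mem_Icc {t : ℝ} (π : TimePartition t) {i : ℕ} (hi : i ≤ π.n) : π.p i ∈ Icc 0 t :=
  ⟨π.first ▸ π.mono i.zero_le, (π.mono hi).trans_eq π.last⟩

/-- Summation by parts. -/
theorem sum_eq {Ω E : Type*} [NormedAddCommGroup E] [NormedSpace ℝ E] {t : ℝ}
    (π : TimePartition t) (f : ℝ → ℝ) (L : ℝ → Ω → E) (ω : Ω) :
    π.sum f L ω = f t • L t ω - f 0 • L 0 ω -
      ∑ i ∈ Finset.range π.n, (f (π.p (i + 1)) - f (π.p i)) • L (π.p (i + 1)) ω := by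
  have h := Finset.sum_range_sub (fun i => f (π.p i) • L (π.p i) ω) π.n
  simp only [π.last, π.first] at h
  rw [← h, ← Finset.sum_sub_distrib]
  refine Finset.sum_congr rfl fun i _ => ?_
  rw [smul_sub, sub_smul]
  abel

/-- The first point of the partition that is not before `s`. -/
noncomputable def next {t : ℝ} (π : TimePartition t) (s : ℝ) : ℝ := π.p (sInf {j | s ≤ π.p j})

theorem next_eq {t : ℝ} (π : TimePartition t) {i : ℕ} {s : ℝ} (hs : s ∈ Ioc (π.p i) (π.p (i + 1))) :
    π.next s = π.p (i + 1) := by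
  have h1 : sInf {j | s ≤ π.p j} ≤ i + 1 := Nat.sInf_le hs.2
  have h2 : s ≤ π.p (sInf {j | s ≤ π.p j}) := Nat.sInf_mem (s := {j | s ≤ π.p j}) ⟨i + 1, hs.2⟩
  have h3 : i < sInf {j | s ≤ π.p j} := by
    by_contra! h
    exact absurd (h2.trans (π.mono h)) hs.1.not_ge
  rw [next, show sInf {j | s ≤ π.p j} = i + 1 by omega]

theorem exists_mem_Ioc {t : ℝ} (π : TimePartition t) {s : ℝ} (hs : s ∈ Ioc 0 t) :
    ∃ i < π.n, s ∈ Ioc (π.p i) (π.p (i + 1)) := by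
  classical
  have hex : ∃ j, s ≤ π.p j := ⟨π.n, hs.2.trans_eq π.last.symm⟩
  obtain ⟨i, hi⟩ : ∃ i, Nat.find hex = i + 1 := by
    refine Nat.exists_eq_succ_of_ne_zero fun h => ?_
    have := Nat.find_spec hex
    rw [h, π.first] at this
    exact absurd this hs.1.not_ge
  refine ⟨i, ?_, ?_, ?_⟩
  · have := Nat.find_min' hex (hs.2.trans_eq π.last.symm)
    omega
  · exact not_le.1 (Nat.find_min hex (by omega : i < Nat.find hex))
  · exact hi ▸ Nat.find_spec hex

theorem next_mem {t : ℝ} (π : TimePartition t) {s : ℝ} (hs : s ∈ Ioc 0 t) :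
    π.next s ∈ Icc s t ∧ π.next s ≤ s + π.mesh := by
  obtain ⟨i, hi, h⟩ := π.exists_mem_Ioc hs
  rw [π.next_eq h]
  exact ⟨⟨h.2, (π.mem_Icc hi).2⟩, by linarith [π.le_mesh hi, h.1]⟩

theorem tendsto_next {t : ℝ} {s : ℝ} (hs : s ∈ Ioc 0 t) :
    Tendsto (fun π : TimePartition t => π.next s) (comap mesh (𝓝 0)) (𝓝[Icc s t] s) := by
  refine tendsto_nhdsWithin_iff.2 ⟨?_, Eventually.of_forall fun π => (π.next_mem hs).1⟩
  refine tendsto_of_tendsto_of_tendsto_of_le_of_le tendsto_const_nhds ?_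
    (fun π => (π.next_mem hs).1.1) (fun π => (π.next_mem hs).2)
  simpa using tendsto_const_nhds.add (tendsto_comap (f := mesh (t := t)) (x := 𝓝 0))

theorem integral_smul_next {E : Type*} [NormedAddCommGroup E] [NormedSpace ℝ E] [CompleteSpace E]
    {t : ℝ} (π : TimePartition t) {f f' : ℝ → ℝ} (hf : ∀ s, HasDerivAt f (f' s) s)
    (hf' : Continuous f') (x : ℝ → E) :
    IntervalIntegrable (fun s => f' s • x (π.next s)) volume 0 t ∧
    ∫ s in (0 : ℝ)..t, f' s • x (π.next s) =
      ∑ i ∈ Finset.range π.n, (f (π.p (i + 1)) - f (π.p i)) • x (π.p (i + 1)) := by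
  have hle : ∀ i, π.p i ≤ π.p (i + 1) := fun i => π.mono i.le_succ
  have heq : ∀ i, EqOn (fun s => f' s • x (π.next s)) (fun s => f' s • x (π.p (i + 1)))
      (uIoc (π.p i) (π.p (i + 1))) := fun i s hs => by
    rw [uIoc_of_le (hle i)] at hs
    simp only [π.next_eq hs]
  have hint : ∀ i < π.n, IntervalIntegrable (fun s => f' s • x (π.next s)) volume
      (π.p i) (π.p (i + 1)) := fun i _ =>
    ((hf'.smul continuous_const).intervalIntegrable _ _).congr fun s hs => (heq i hs).symm
  have h1 := IntervalIntegrable.trans_iterate hint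
  have h2 := intervalIntegral.sum_integral_adjacent_intervals hint
  rw [π.first, π.last] at h1 h2
  refine ⟨h1, h2.symm.trans (Finset.sum_congr rfl fun i _ => ?_)⟩
  rw [intervalIntegral.integral_congr_ae (g := fun s => f' s • x (π.p (i + 1)))
    (ae_of_all _ fun s hs => heq i hs), intervalIntegral.integral_smul_const,
    intervalIntegral.integral_eq_sub_of_hasDerivAt (fun s _ => hf s)
      (hf'.intervalIntegrable _ _)]

theorem tendsto_integral_next {E : Type*} [NormedAddCommGroup E] [NormedSpace ℝ E]
    [CompleteSpace E] {t : ℝ} (ht : 0 ≤ t) {f' : ℝ → ℝ} (hf' : Continuous f') {x : ℝ → E}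
    (hx : IsCadlagOn t x) :
    Tendsto (fun π : TimePartition t => ∫ s in (0 : ℝ)..t, f' s • x (π.next s))
      (comap mesh (𝓝 0)) (𝓝 (∫ s in (0 : ℝ)..t, f' s • x s)) := by
  obtain ⟨C, hC0, hC⟩ := hx.exists_norm_le
  have hf : ∀ s, HasDerivAt (fun u => ∫ r in (0 : ℝ)..u, f' r) (f' s) s := fun s =>
    intervalIntegral.integral_hasDerivAt_right (hf'.intervalIntegrable _ _)
      hf'.aestronglyMeasurable.stronglyMeasurableAtFilter hf'.continuousAt
  refine intervalIntegral.tendsto_integral_filter_of_dominated_convergence (fun s => |f' s| * C)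
    (Eventually.of_forall fun π => ?_) (Eventually.of_forall fun π => ae_of_all _ fun s hs => ?_)
    ((hf'.abs.mul continuous_const).intervalIntegrable _ _) (ae_of_all _ fun s hs => ?_)
  · exact (intervalIntegrable_iff.1 (π.integral_smul_next hf hf' x).1).aestronglyMeasurable
  · rw [uIoc_of_le ht] at hs
    rw [norm_smul, Real.norm_eq_abs]
    gcongr
    exact hC _ ⟨hs.1.le.trans (π.next_mem hs).1.1, (π.next_mem hs).1.2⟩
  · rw [uIoc_of_le ht] at hs
    exact (((hx s ⟨hs.1.le, hs.2⟩).1.tendsto).comp (tendsto_next hs)).const_smul (f' s)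

theorem tendsto_sum_exp {Ω E : Type*} [NormedAddCommGroup E] [NormedSpace ℝ E]
    [CompleteSpace E] {t a : ℝ} (ht : 0 ≤ t) {L : ℝ → Ω → E} {ω : Ω} (h0 : L 0 ω = 0)
    (hL : IsCadlagOn t (fun s => L s ω)) :
    Tendsto (fun π : TimePartition t => π.sum (fun s => Real.exp (-(a * (t - s)))) L ω)
      (comap mesh (𝓝 0)) (𝓝 (ouPath a (fun s => L s ω) t)) := by
  have hf : ∀ s, HasDerivAt (fun s => Real.exp (-(a * (t - s))))
      (a * Real.exp (-(a * (t - s)))) s := fun s => by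
    have : HasDerivAt (fun s => -(a * (t - s))) a s := by
      simpa using ((hasDerivAt_id s).const_sub t).const_mul (-a)
    simpa [mul_comm] using this.exp
  have hf' : Continuous fun s => a * Real.exp (-(a * (t - s))) := by fun_prop
  have h := (tendsto_const_nhds (x := L t ω)).sub (tendsto_integral_next ht hf' hL)
  have hlim : L t ω - ∫ s in (0 : ℝ)..t, (a * Real.exp (-(a * (t - s)))) • L s ω =
      ouPath a (fun s => L s ω) t := by
    rw [ouPath, ← intervalIntegral.integral_smul]
    congr 2 with s
    rw [smul_smul, mul_assoc, ← Real.exp_add]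
    ring_nf
  rw [hlim] at h
  refine h.congr fun π => ?_
  rw [sum_eq, (π.integral_smul_next hf hf' fun s => L s ω).2]
  simp [h0]

/-- The partition of `[0, t]` into `n + 1` intervals of equal length. -/
noncomputable def uniform {t : ℝ} (ht : 0 ≤ t) (n : ℕ) : TimePartition t where
  n := n + 1
  p i := min t (i * (t / (n + 1)))
  mono i j hij := by
    have : (i : ℝ) ≤ j := by exact_mod_cast hij
    exact min_le_min_left _ (by gcongr)
  first := by simp [ht]
  last := by
    rw [Nat.cast_add, Nat.cast_one, mul_div_cancel₀ _ (by positivity), min_self]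

theorem uniform_p {t : ℝ} (ht : 0 ≤ t) {n i : ℕ} (hi : i ≤ n + 1) :
    (uniform ht n).p i = i * (t / (n + 1)) := by
  refine min_eq_right ?_
  have : (i : ℝ) ≤ n + 1 := by exact_mod_cast hi
  calc i * (t / (n + 1)) ≤ (n + 1) * (t / (n + 1)) := by gcongr
    _ = t := mul_div_cancel₀ _ (by positivity)

theorem uniform_sub {t : ℝ} (ht : 0 ≤ t) {n i : ℕ} (hi : i < n + 1) :
    (uniform ht n).p (i + 1) - (uniform ht n).p i = t / (n + 1) := by
  rw [uniform_p ht (by omega), uniform_p ht (by omega)]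
  push_cast
  ring

theorem mesh_uniform {t : ℝ} (ht : 0 ≤ t) (n : ℕ) : (uniform ht n).mesh = t / (n + 1) := by
  have : Nonempty (Fin (uniform ht n).n) := ⟨⟨0, n.succ_pos⟩⟩
  rw [mesh]
  simp only [fun i : Fin (uniform ht n).n => uniform_sub ht i.2, ciSup_const]

theorem tendsto_uniform {t : ℝ} (ht : 0 ≤ t) :
    Tendsto (fun n => uniform ht n) atTop (comap mesh (𝓝 0)) := by
  rw [tendsto_comap_iff]
  simp only [Function.comp_def, mesh_uniform]
  simpa [div_eq_mul_inv] using
    (tendsto_one_div_add_atTop_nhds_zero_nat (𝕜 := ℝ)).const_mul t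

theorem comap_mesh_neBot {t : ℝ} (ht : 0 ≤ t) :
    (comap (mesh (t := t)) (𝓝 0)).NeBot :=
  (tendsto_uniform ht).neBot

end TimePartition

theorem tendstoInMeasure_of_tendsto_ae_filter {Ω ι E : Type*} [MeasurableSpace Ω] {P : Measure Ω}
    [IsFiniteMeasure P] [PseudoEMetricSpace E] {l : Filter ι} [l.IsCountablyGenerated]
    {f : ι → Ω → E} {g : Ω → E} (hf : ∀ i, AEStronglyMeasurable (f i) P)
    (h : ∀ᵐ ω ∂P, Tendsto (fun i => f i ω) l (𝓝 (g ω))) : TendstoInMeasure P f l g := by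
  intro δ hδ
  refine tendsto_of_seq_tendsto fun u hu => ?_
  exact tendstoInMeasure_of_tendsto_ae (fun n => hf (u n)) (h.mono fun ω hω => hω.comp hu) δ hδ

/-- A countable set on which the values determine a càdlàg function on `[0, T]`. -/
def cadlagSkeleton (T : ℝ) : Set ℝ := insert T (Icc 0 T ∩ range ((↑) : ℚ → ℝ))

theorem countable_cadlagSkeleton (T : ℝ) : (cadlagSkeleton T).Countable :=
  ((countable_range _).mono inter_subset_right).insert T

theorem IsCadlagOn.eqOn {E : Type*} [TopologicalSpace E] [T2Space E] {T : ℝ} {x y : ℝ → E}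
    (hx : IsCadlagOn T x) (hy : IsCadlagOn T y) (h : EqOn x y (cadlagSkeleton T)) :
    EqOn x y (Icc 0 T) := by
  intro t ht
  rcases ht.2.eq_or_lt with rfl | htT
  · exact h (mem_insert _ _)
  · have hcl : t ∈ closure (Ioo t T ∩ range ((↑) : ℚ → ℝ)) := by
      refine closure_minimal (Rat.denseRange_cast.open_subset_closure_inter isOpen_Ioo)
        isClosed_closure ?_
      rw [closure_Ioo htT.ne]
      exact left_mem_Icc.2 htT.le
    have := mem_closure_iff_nhdsWithin_neBot.1 hcl
    have hsub : Ioo t T ∩ range ((↑) : ℚ → ℝ) ⊆ Icc t T :=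
      inter_subset_left.trans Ioo_subset_Icc_self
    refine tendsto_nhds_unique_of_eventuallyEq ((hx t ht).1.mono hsub) ((hy t ht).1.mono hsub) ?_
    filter_upwards [self_mem_nhdsWithin] with s hs
    exact h (mem_insert_of_mem _ ⟨⟨ht.1.trans hs.1.1.le, hs.1.2.le⟩, hs.2⟩)

theorem indistinguishable_of_isCadlagOn {Ω E : Type*} [MeasurableSpace Ω] {P : Measure Ω}
    [TopologicalSpace E] [T2Space E] {T : ℝ} (hT : 0 ≤ T) {X Y : ℝ → Ω → E}
    (hX : ∀ᵐ ω ∂P, IsCadlagOn T (fun t => X t ω)) (hY : ∀ᵐ ω ∂P, IsCadlagOn T (fun t => Y t ω))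
    (h : ∀ t ∈ Icc 0 T, X t =ᵐ[P] Y t) : ∀ᵐ ω ∂P, ∀ t ∈ Icc 0 T, X t ω = Y t ω := by
  have hD : ∀ᵐ ω ∂P, ∀ t ∈ cadlagSkeleton T, X t ω = Y t ω := by
    refine (ae_ball_iff (countable_cadlagSkeleton T)).2 fun t ht => h t ?_
    rcases ht with rfl | ht
    · exact right_mem_Icc.2 hT
    · exact ht.1
  filter_upwards [hX, hY, hD] with ω h1 h2 h3 t ht using h1.eqOn h2 h3 ht

section

variable {Ω E : Type*} [MeasurableSpace Ω] [NormedAddCommGroup E] [MeasurableSpace E]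
  {P : Measure Ω} {T : ℝ} {L : ℝ → Ω → E}

theorem TimePartition.aemeasurable_sum [NormedSpace ℝ E] [BorelSpace E]
    [SecondCountableTopology E] (hL : ∀ t ∈ Icc 0 T, AEMeasurable (L t) P)
    {t : ℝ} (ht : t ∈ Icc 0 T) (π : TimePartition t) (f : ℝ → ℝ) :
    AEMeasurable (π.sum f L) P := by
  refine Finset.aemeasurable_fun_sum _ fun i hi => ?_
  have hi' := Finset.mem_range.1 hi
  have h : ∀ j ≤ π.n, AEMeasurable (L (π.p j)) P := fun j hj =>
    hL _ (Icc_subset_Icc_right ht.2 (π.mem_Icc hj))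
  exact ((h _ hi').sub (h _ hi'.le)).const_smul _

variable [NormedSpace ℝ E] [CompleteSpace E]

theorem IsLevyProcessOn.tendsto_sum_exp (hL : IsLevyProcessOn P T L) (a : ℝ) {t : ℝ}
    (ht : t ∈ Icc 0 T) :
    ∀ᵐ ω ∂P, Tendsto (fun π : TimePartition t => π.sum (fun s => Real.exp (-(a * (t - s)))) L ω)
      (comap TimePartition.mesh (𝓝 0)) (𝓝 (ouPath a (fun s => L s ω) t)) := by
  filter_upwards [hL.zero, hL.cadlag] with ω h0 hc
  exact TimePartition.tendsto_sum_exp ht.1 h0 (hc.mono ht.2)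

variable [BorelSpace E] [SecondCountableTopology E] [IsFiniteMeasure P]

theorem IsLevyProcessOn.isStochasticIntegral_ouPath (hL : IsLevyProcessOn P T L) (a : ℝ) {t : ℝ}
    (ht : t ∈ Icc 0 T) :
    IsStochasticIntegral P (fun s => Real.exp (-(a * (t - s)))) L t
      (fun ω => ouPath a (fun s => L s ω) t) := by
  have := TimePartition.comap_mesh_neBot ht.1
  have hm := fun π : TimePartition t => π.aemeasurable_sum hL.aemeasurable ht
    (fun s => Real.exp (-(a * (t - s))))
  exact ⟨aemeasurable_of_tendsto_metrizable_ae _ hm (hL.tendsto_sum_exp a ht),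
    tendstoInMeasure_of_tendsto_ae_filter (fun π => (hm π).aestronglyMeasurable)
      (hL.tendsto_sum_exp a ht)⟩

theorem IsLevyProcessOn.isOUIntegral_ouPath (hL : IsLevyProcessOn P T L) (hT : 0 ≤ T) (ε : ℝ) :
    IsOUIntegral P T ε L (fun t ω => ouPath ε⁻¹ (fun s => L s ω) t) where
  cadlag := hL.cadlag.mono fun _ h => h.ouPath hT _
  eq_integral _ ht := hL.isStochasticIntegral_ouPath _ ht

theorem IsLevyProcessOn.isOUIntegral_iff_solvesOU (hL : IsLevyProcessOn P T L) (hT : 0 ≤ T)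
    {ε : ℝ} {Z : ℝ → Ω → E} : IsOUIntegral P T ε L Z ↔ SolvesOU P T ε L Z := by
  have hY := hL.isOUIntegral_ouPath hT ε
  constructor
  · intro hZ
    have heq := indistinguishable_of_isCadlagOn hT hZ.cadlag hY.cadlag fun t ht => by
      have := TimePartition.comap_mesh_neBot ht.1
      exact tendstoInMeasure_ae_unique (hZ.eq_integral t ht).2 (hY.eq_integral t ht).2
    have hsol : ∀ᵐ ω ∂P, ∀ t ∈ Icc 0 T,
        Z t ω = -(ε⁻¹ • ∫ s in (0 : ℝ)..t, Z s ω) + (L t ω - L 0 ω) := by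
      filter_upwards [heq, hL.cadlag, hL.zero] with ω h hc h0 t ht
      rw [h t ht, ouPath_eq hc ht, h0, sub_zero]
      congr 3
      refine intervalIntegral.integral_congr fun s hs => (h s ?_).symm
      rw [uIcc_of_le ht.1] at hs
      exact Icc_subset_Icc_right ht.2 hs
    refine ⟨fun t ht => (hZ.eq_integral t ht).1, hZ.cadlag, ?_, hsol⟩
    filter_upwards [hsol] with ω h
    simpa using h 0 (left_mem_Icc.2 hT)
  · intro hZ
    refine ⟨hZ.cadlag, fun t ht => ?_⟩
    have heq : (fun ω => ouPath ε⁻¹ (fun s => L s ω) t) =ᵐ[P] Z t := by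
      filter_upwards [hZ.cadlag, hZ.eq, hL.cadlag, hL.zero] with ω hc h hLc h0
      exact (eq_ouPath hLc hc (fun t ht => by simpa [h0] using h t ht) ht).symm
    have h := hL.isStochasticIntegral_ouPath ε⁻¹ ht
    exact ⟨h.1.congr heq, h.2.congr_right heq⟩

end

theorem measureReal_abs_inner_gt_le_of_charFun_eq {E : Type*} [NormedAddCommGroup E]
    [InnerProductSpace ℝ E] [MeasurableSpace E] [OpensMeasurableSpace E] {μ : Measure E}
    [IsProbabilityMeasure μ] {κ α : ℝ} (hκ : 0 ≤ κ) (hα : 0 < α)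
    (hμ : ∀ h, charFun μ h = (Real.exp (-(κ * ‖h‖ ^ α)) : ℂ)) {e : E} (he : ‖e‖ = 1) {r : ℝ}
    (hr : 0 < r) : μ.real {x | r < |inner ℝ e x|} ≤ 2 * 2 ^ α * κ * r ^ (-α) := by
  refine (measureReal_abs_inner_gt_le_integral_charFun hr).trans ?_
  have hb : ∀ s ∈ uIoc (-2 * r⁻¹) (2 * r⁻¹), ‖1 - charFun μ (s • e)‖ ≤ κ * (2 * r⁻¹) ^ α := by
    intro s hs
    have hr' : 0 < r⁻¹ := inv_pos.2 hr
    rw [uIoc_of_le (by linarith)] at hs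
    have hs' : |s| ≤ 2 * r⁻¹ := abs_le.2 ⟨by linarith [hs.1], hs.2⟩
    have h0 : 0 ≤ κ * |s| ^ α := by positivity
    rw [hμ, norm_smul, he, mul_one, Real.norm_eq_abs, ← Complex.ofReal_one, ← Complex.ofReal_sub,
      Complex.norm_real, Real.norm_eq_abs, abs_of_nonneg]
    · refine le_trans ?_ (mul_le_mul_of_nonneg_left (Real.rpow_le_rpow (abs_nonneg s) hs' hα.le) hκ)
      linarith [Real.add_one_le_exp (-(κ * |s| ^ α))]
    · rw [sub_nonneg, Real.exp_le_one_iff]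
      linarith
  refine (mul_le_mul_of_nonneg_left (intervalIntegral.norm_integral_le_of_norm_le_const hb)
    (by positivity)).trans_eq ?_
  rw [show 2 * r⁻¹ - -2 * r⁻¹ = 4 * r⁻¹ by ring, abs_of_pos (by positivity),
    Real.mul_rpow (by norm_num) (by positivity), Real.inv_rpow hr.le, Real.rpow_neg hr.le]
  field_simp
  ring

theorem lintegral_enorm_le_of_tail_le {Ω : Type*} [MeasurableSpace Ω] {P : Measure Ω}
    [IsProbabilityMeasure P] {X : Ω → ℝ} (hX : AEMeasurable X P) {K α : ℝ} (hα : 1 < α)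
    (hK : 0 ≤ K) (htail : ∀ r, 0 < r → P.real {ω | r < |X ω|} ≤ K * r ^ (-α)) {δ : ℝ}
    (hδ : 0 < δ) :
    ∫⁻ ω, ‖X ω‖ₑ ∂P ≤ ENNReal.ofReal (δ + K * (δ ^ (1 - α) / (α - 1))) := by
  have h1 : ∫⁻ ω, ‖X ω‖ₑ ∂P = ∫⁻ r in Ioi (0 : ℝ), P {ω | r < |X ω|} := by
    rw [← lintegral_eq_lintegral_meas_lt P (ae_of_all _ fun ω => abs_nonneg (X ω)) hX.abs]
    simp [← Real.norm_eq_abs]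
  have hI : ∫ r in Ioi δ, K * r ^ (-α) = K * (δ ^ (1 - α) / (α - 1)) := by
    rw [integral_const_mul, integral_Ioi_rpow_of_lt (by linarith) hδ,
      show -α + 1 = -(α - 1) by ring, show 1 - α = -(α - 1) by ring, neg_div_neg_eq]
  rw [h1, ← Ioc_union_Ioi_eq_Ioi hδ.le, ENNReal.ofReal_add hδ.le (by
    have : 0 < α - 1 := by linarith
    positivity)]
  refine (lintegral_union_le _ _ _).trans (add_le_add ?_ ?_)
  · calc ∫⁻ r in Ioc 0 δ, P {ω | r < |X ω|} ≤ ∫⁻ r in Ioc 0 δ, 1 :=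
        lintegral_mono fun r => prob_le_one
      _ = ENNReal.ofReal δ := by simp
  · rw [← hI, ofReal_integral_eq_lintegral_ofReal
      ((integrableOn_Ioi_rpow_of_lt (by linarith) hδ).const_mul K)
      ((ae_restrict_iff' measurableSet_Ioi).2 (ae_of_all _ fun r hr => by
        have : 0 < r := hδ.trans hr
        simp only [Pi.zero_apply]; positivity))]
    refine setLIntegral_mono' measurableSet_Ioi fun r hr => ?_
    rw [← ofReal_measureReal]
    exact ENNReal.ofReal_le_ofReal (htail r (hδ.trans hr))

theorem IsIsotropicStableOn.lintegral_enorm_le {Ω : Type*} [MeasurableSpace Ω] {P : Measure Ω}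
    [IsProbabilityMeasure P] {d : ℕ} {T α : ℝ} (hα : 1 < α)
    {L : ℝ → Ω → EuclideanSpace ℝ (Fin d)} (hL : IsIsotropicStableOn P T α L) {δ : ℝ}
    (hδ : 0 < δ) :
    ∃ M, 0 ≤ M ∧ ∀ u ∈ Icc 0 T, ∫⁻ ω, ‖L u ω‖ₑ ∂P ≤ ENNReal.ofReal (δ + M * u) := by
  obtain ⟨c, hc, hφ⟩ := hL.charFun_eq
  have hα' : 0 < α - 1 := by linarith
  set η := δ / (d + 1) with hη
  have hη0 : 0 < η := by positivity
  set M₀ := 2 * 2 ^ α * c * (η ^ (1 - α) / (α - 1)) with hM₀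
  have hM0 : 0 ≤ M₀ := by positivity
  refine ⟨d * M₀, by positivity, fun u hu => ?_⟩
  have hu0 := hu.1
  have hcu : 0 ≤ c * u := mul_nonneg hc.le hu0
  have hm := hL.aemeasurable u hu
  have := Measure.isProbabilityMeasure_map hm
  have hj : ∀ j : Fin d, ∫⁻ ω, ‖L u ω j‖ₑ ∂P ≤ ENNReal.ofReal (η + M₀ * u) := fun j => by
    have hmj : AEMeasurable (fun ω => L u ω j) P :=
      (EuclideanSpace.proj (𝕜 := ℝ) j).continuous.measurable.comp_aemeasurable hm
    refine (lintegral_enorm_le_of_tail_le hmj hα (K := 2 * 2 ^ α * (c * u)) (by positivity)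
      (fun r hr => ?_) hη0).trans_eq (by rw [hM₀]; ring_nf)
    have h := measureReal_abs_inner_gt_le_of_charFun_eq hcu (by linarith) (hφ u hu)
      (e := EuclideanSpace.single j (1 : ℝ)) (by simp) hr
    rw [map_measureReal_apply_of_aemeasurable hm] at h
    · simpa [EuclideanSpace.inner_single_left] using h
    · exact measurableSet_lt measurable_const (by fun_prop)
  calc ∫⁻ ω, ‖L u ω‖ₑ ∂P ≤ ∫⁻ ω, ∑ j, ‖L u ω j‖ₑ ∂P := by
        refine lintegral_mono fun ω => ?_
        conv_lhs => rw [← (EuclideanSpace.basisFun (Fin d) ℝ).sum_repr (L u ω)]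
        refine (enorm_sum_le _ _).trans (Finset.sum_le_sum fun j _ => ?_)
        rw [enorm_smul]
        simp [← ofReal_norm]
    _ = ∑ j, ∫⁻ ω, ‖L u ω j‖ₑ ∂P := lintegral_finsetSum' _ fun j _ =>
        ((EuclideanSpace.proj (𝕜 := ℝ) j).continuous.measurable.comp_aemeasurable hm).enorm
    _ ≤ ∑ j : Fin d, ENNReal.ofReal (η + M₀ * u) := Finset.sum_le_sum fun j _ => hj j
    _ = ENNReal.ofReal (d * (η + M₀ * u)) := by
        rw [ENNReal.ofReal_mul (by positivity)]
        simp
    _ ≤ ENNReal.ofReal (δ + d * M₀ * u) := by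
        refine ENNReal.ofReal_le_ofReal ?_
        have : d * η ≤ δ := by
          rw [hη, ← mul_div_assoc, div_le_iff₀ (by positivity)]
          nlinarith
        linarith

namespace TimePartition

theorem sum_exp_mul_le {t a : ℝ} (ha : 0 < a) (π : TimePartition t) :
    ∑ i ∈ Finset.range π.n, Real.exp (-(a * (t - π.p i))) * (π.p (i + 1) - π.p i) ≤ a⁻¹ := by
  have h := Finset.sum_range_sub (fun i => a⁻¹ * Real.exp (-(a * (t - π.p i)))) π.n
  have h2 : ∑ i ∈ Finset.range π.n, Real.exp (-(a * (t - π.p i))) * (π.p (i + 1) - π.p i) ≤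
      a⁻¹ * Real.exp (-(a * (t - π.p π.n))) - a⁻¹ * Real.exp (-(a * (t - π.p 0))) := by
    rw [← h]
    refine Finset.sum_le_sum fun i _ => ?_
    rw [← mul_sub, inv_mul_eq_div, le_div_iff₀ ha,
      show -(a * (t - π.p (i + 1))) = -(a * (t - π.p i)) + a * (π.p (i + 1) - π.p i) by ring,
      Real.exp_add]
    nlinarith [Real.exp_pos (-(a * (t - π.p i))),
      Real.add_one_le_exp (a * (π.p (i + 1) - π.p i))]
  rw [π.last, sub_self, mul_zero, neg_zero, Real.exp_zero, mul_one] at h2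
  have : 0 ≤ a⁻¹ * Real.exp (-(a * (t - π.p 0))) := by positivity
  linarith

end TimePartition

section

variable {Ω E : Type*} [MeasurableSpace Ω] [NormedAddCommGroup E] [MeasurableSpace E]
  [BorelSpace E] {P : Measure Ω} {T : ℝ} {L : ℝ → Ω → E}

theorem IsLevyProcessOn.lintegral_enorm_sub (hL : IsLevyProcessOn P T L) {s t : ℝ} (hs : 0 ≤ s)
    (hst : s ≤ t) (ht : t ≤ T) :
    ∫⁻ ω, ‖L t ω - L s ω‖ₑ ∂P = ∫⁻ ω, ‖L (t - s) ω‖ₑ ∂P :=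
  ((hL.stationary s t hs hst ht).comp measurable_enorm).lintegral_eq

variable [NormedSpace ℝ E] [SecondCountableTopology E]

theorem IsLevyProcessOn.lintegral_enorm_sum_exp_le (hL : IsLevyProcessOn P T L) {δ M : ℝ}
    (hδ : 0 ≤ δ) (hM : 0 ≤ M)
    (hLM : ∀ u ∈ Icc 0 T, ∫⁻ ω, ‖L u ω‖ₑ ∂P ≤ ENNReal.ofReal (δ + M * u)) {a : ℝ} (ha : 0 < a)
    {t : ℝ} (ht : t ∈ Icc 0 T) (π : TimePartition t) :
    ∫⁻ ω, ‖π.sum (fun s => Real.exp (-(a * (t - s)))) L ω‖ₑ ∂P ≤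
      ENNReal.ofReal (δ + M * a⁻¹) := by
  set f : ℝ → ℝ := fun s => Real.exp (-(a * (t - s))) with hf
  have hft : f t = 1 := by simp [hf]
  have hf0 : ∀ s, 0 ≤ f s := fun s => (Real.exp_pos _).le
  have hΔ : ∀ i, 0 ≤ f (π.p (i + 1)) - f (π.p i) := fun i => by
    have := π.mono i.le_succ
    simp only [hf, sub_nonneg, Real.exp_le_exp]
    nlinarith
  have htel : ∑ i ∈ Finset.range π.n, (f (π.p (i + 1)) - f (π.p i)) = 1 - f 0 := by
    rw [Finset.sum_range_sub (fun i => f (π.p i)), π.last, π.first, hft]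
  have hsum : ∀ ω, π.sum f L ω = f 0 • (L t ω - L 0 ω) +
      ∑ i ∈ Finset.range π.n,
        (f (π.p (i + 1)) - f (π.p i)) • (L t ω - L (π.p (i + 1)) ω) := fun ω => by
    simp only [smul_sub, Finset.sum_sub_distrib, ← Finset.sum_smul, htel, π.sum_eq, hft]
    rw [sub_smul, one_smul]
    abel
  have hmem : ∀ i ∈ Finset.range π.n, π.p (i + 1) ∈ Icc 0 t := fun i hi =>
    π.mem_Icc (Finset.mem_range.1 hi)
  have h0T : (0 : ℝ) ∈ Icc 0 t := left_mem_Icc.2 ht.1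
  have hterm : ∀ b, 0 ≤ b → ∀ s ∈ Icc 0 t, ∫⁻ ω, ‖b • (L t ω - L s ω)‖ₑ ∂P ≤
      ENNReal.ofReal (b * (δ + M * (t - s))) := fun b hb s hs => by
    simp only [enorm_smul, Real.enorm_of_nonneg hb]
    rw [lintegral_const_mul' _ _ ENNReal.ofReal_ne_top, hL.lintegral_enorm_sub hs.1 hs.2 ht.2,
      ENNReal.ofReal_mul hb]
    gcongr
    exact hLM _ ⟨by linarith [hs.2], by linarith [hs.1, ht.2]⟩
  have hmeas : ∀ b : ℝ, ∀ s ∈ Icc 0 t, AEMeasurable (fun ω => ‖b • (L t ω - L s ω)‖ₑ) P :=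
    fun b s hs => (((hL.aemeasurable t ht).sub
      (hL.aemeasurable s (Icc_subset_Icc_right ht.2 hs))).const_smul b).enorm
  have hnn : ∀ b, 0 ≤ b → ∀ s ∈ Icc 0 t, 0 ≤ b * (δ + M * (t - s)) := fun b hb s hs => by
    have : 0 ≤ t - s := by linarith [hs.2]
    positivity
  calc ∫⁻ ω, ‖π.sum f L ω‖ₑ ∂P
      ≤ ∫⁻ ω, (‖f 0 • (L t ω - L 0 ω)‖ₑ + ∑ i ∈ Finset.range π.n,
        ‖(f (π.p (i + 1)) - f (π.p i)) • (L t ω - L (π.p (i + 1)) ω)‖ₑ) ∂P := by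
        refine lintegral_mono fun ω => ?_
        rw [hsum]
        exact (enorm_add_le _ _).trans (by gcongr; exact enorm_sum_le _ _)
    _ = ∫⁻ ω, ‖f 0 • (L t ω - L 0 ω)‖ₑ ∂P + ∑ i ∈ Finset.range π.n,
        ∫⁻ ω, ‖(f (π.p (i + 1)) - f (π.p i)) • (L t ω - L (π.p (i + 1)) ω)‖ₑ ∂P := by
        rw [lintegral_add_left' (hmeas _ _ h0T),
          lintegral_finsetSum' _ fun i hi => hmeas _ _ (hmem i hi)]
    _ ≤ ENNReal.ofReal (f 0 * (δ + M * (t - 0))) + ∑ i ∈ Finset.range π.n,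
        ENNReal.ofReal ((f (π.p (i + 1)) - f (π.p i)) * (δ + M * (t - π.p (i + 1)))) :=
        add_le_add (hterm _ (hf0 0) _ h0T)
          (Finset.sum_le_sum fun i hi => hterm _ (hΔ i) _ (hmem i hi))
    _ = ENNReal.ofReal (δ + M * ∑ i ∈ Finset.range π.n, f (π.p i) * (π.p (i + 1) - π.p i)) := by
        rw [← ENNReal.ofReal_sum_of_nonneg fun i hi => hnn _ (hΔ i) _ (hmem i hi),
          ← ENNReal.ofReal_add (hnn _ (hf0 0) _ h0T)
            (Finset.sum_nonneg fun i hi => hnn _ (hΔ i) _ (hmem i hi))]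
        congr 1
        have hid := π.sum_eq f (fun s (_ : Unit) => s) ()
        simp only [TimePartition.sum, smul_eq_mul, hft] at hid
        rw [hid]
        have hexp : ∑ i ∈ Finset.range π.n,
            (f (π.p (i + 1)) - f (π.p i)) * (δ + M * (t - π.p (i + 1))) =
            (δ + M * t) * (1 - f 0) - M * ∑ i ∈ Finset.range π.n,
              (f (π.p (i + 1)) - f (π.p i)) * π.p (i + 1) := by
          rw [← htel, Finset.mul_sum, Finset.mul_sum, ← Finset.sum_sub_distrib]
          exact Finset.sum_congr rfl fun i _ => by ring
        rw [hexp]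
        ring
    _ ≤ ENNReal.ofReal (δ + M * a⁻¹) := by
        gcongr
        exact π.sum_exp_mul_le ha

theorem IsLevyProcessOn.lintegral_enorm_ouPath_le [CompleteSpace E] (hL : IsLevyProcessOn P T L)
    {δ M : ℝ} (hδ : 0 ≤ δ) (hM : 0 ≤ M)
    (hLM : ∀ u ∈ Icc 0 T, ∫⁻ ω, ‖L u ω‖ₑ ∂P ≤ ENNReal.ofReal (δ + M * u)) {a : ℝ} (ha : 0 < a)
    {t : ℝ} (ht : t ∈ Icc 0 T) :
    ∫⁻ ω, ‖ouPath a (fun s => L s ω) t‖ₑ ∂P ≤ ENNReal.ofReal (δ + M * a⁻¹) := by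
  have := TimePartition.comap_mesh_neBot ht.1
  set f : ℝ → ℝ := fun s => Real.exp (-(a * (t - s))) with hf
  calc ∫⁻ ω, ‖ouPath a (fun s => L s ω) t‖ₑ ∂P
      = ∫⁻ ω, liminf (fun π : TimePartition t => ‖π.sum f L ω‖ₑ)
          (comap TimePartition.mesh (𝓝 0)) ∂P := by
        refine lintegral_congr_ae ?_
        filter_upwards [hL.tendsto_sum_exp a ht] with ω h
        exact h.enorm.liminf_eq.symm
    _ ≤ liminf (fun π : TimePartition t => ∫⁻ ω, ‖π.sum f L ω‖ₑ ∂P)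
          (comap TimePartition.mesh (𝓝 0)) :=
        lintegral_liminf_le' fun π => (π.aemeasurable_sum hL.aemeasurable ht f).enorm
    _ ≤ ENNReal.ofReal (δ + M * a⁻¹) :=
        (liminf_le_liminf (Eventually.of_forall fun π =>
          hL.lintegral_enorm_sum_exp_le hδ hM hLM ha ht π)).trans_eq (liminf_const _)

end

theorem mul_one_sub_cos_le {η y : ℝ} (hη : η ≤ Real.pi) :
    2 * (1 + Real.cos η) * (1 - Real.cos y) ≤
      (1 - Real.cos (2 * y)) + 2 * (2 * (1 + Real.cos η)) * {y | η < |y|}.indicator 1 y := by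
  have h1 := Real.cos_le_one y
  have h2 := Real.neg_one_le_cos y
  have h3 := Real.neg_one_le_cos η
  rw [Real.cos_two_mul]
  by_cases h : η < |y|
  · rw [indicator_of_mem (by exact h)]
    simp only [Pi.one_apply]
    nlinarith [mul_nonneg (by linarith : 0 ≤ 1 + Real.cos η) (by linarith : 0 ≤ 1 + Real.cos y),
      mul_nonneg (by linarith : 0 ≤ 1 - Real.cos y) (by linarith : 0 ≤ 1 + Real.cos y)]
  · rw [indicator_of_notMem (by exact h)]
    have h4 : Real.cos η ≤ Real.cos y := by
      rw [← Real.cos_abs y]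
      exact Real.cos_le_cos_of_nonneg_of_le_pi (abs_nonneg y) hη (not_lt.1 h)
    nlinarith [mul_nonneg (by linarith : 0 ≤ 1 - Real.cos y)
      (by linarith : 0 ≤ Real.cos y - Real.cos η)]

theorem re_charFun {E : Type*} [NormedAddCommGroup E] [InnerProductSpace ℝ E] [MeasurableSpace E]
    [OpensMeasurableSpace E] [SecondCountableTopology E] (μ : Measure E) [IsFiniteMeasure μ]
    (h : E) : (charFun μ h).re = ∫ x, Real.cos (inner ℝ x h) ∂μ := by
  have hint : Integrable (fun x => Complex.exp ((inner ℝ x h : ℝ) * Complex.I)) μ := by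
    refine Integrable.of_bound (by fun_prop) 1 (ae_of_all _ fun x => ?_)
    rw [Complex.norm_exp_ofReal_mul_I]
  rw [charFun_apply]
  refine (Complex.reCLM.integral_comp_comm hint).symm.trans (integral_congr_ae ?_)
  exact ae_of_all _ fun x => Complex.exp_ofReal_mul_I_re _

section

variable {E : Type*} [NormedAddCommGroup E] [InnerProductSpace ℝ E] [MeasurableSpace E]
  [BorelSpace E] [SecondCountableTopology E]

theorem le_measureReal_norm_gt_of_charFun_eq {μ : Measure E} [IsProbabilityMeasure μ] {κ α : ℝ}
    (hμ : ∀ h, charFun μ h = (Real.exp (-(κ * ‖h‖ ^ α)) : ℂ)) {e : E} (he : ‖e‖ = 1) {η : ℝ}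
    (hη : η ≤ Real.pi) :
    2 * (1 + Real.cos η) * (1 - Real.exp (-κ)) ≤ (1 - Real.exp (-(κ * 2 ^ α))) +
      2 * (2 * (1 + Real.cos η)) * μ.real {x | η < ‖x‖} := by
  have hcos : ∀ b : ℝ, Integrable (fun x => Real.cos (b * inner ℝ x e)) μ := fun b =>
    Integrable.of_bound (by fun_prop) 1 (ae_of_all _ fun x => by
      rw [Real.norm_eq_abs]; exact Real.abs_cos_le_one _)
  have hφ : ∀ b : ℝ, 0 ≤ b →
      ∫ x, (1 - Real.cos (b * inner ℝ x e)) ∂μ = 1 - Real.exp (-(κ * b ^ α)) := fun b hb => by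
    have h := re_charFun μ (b • e)
    rw [hμ, Complex.ofReal_re, norm_smul, he, mul_one, Real.norm_of_nonneg hb] at h
    rw [integral_sub (integrable_const _) (hcos b), h]
    simp [real_inner_smul_right]
  have hcos' : ∀ b : ℝ, Integrable (fun x => 1 - Real.cos (b * inner ℝ x e)) μ := fun b =>
    (integrable_const _).sub (hcos b)
  have hS : MeasurableSet {x : E | η < |inner ℝ x e|} :=
    measurableSet_lt measurable_const (by fun_prop)
  have hSi : Integrable (fun x => 2 * (2 * (1 + Real.cos η)) *
      {x : E | η < |inner ℝ x e|}.indicator (1 : E → ℝ) x) μ :=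
    ((integrable_const (1 : ℝ)).indicator hS).const_mul _
  have h1 := hφ 1 zero_le_one
  rw [Real.one_rpow, mul_one] at h1
  have hle : μ.real {x | η < |inner ℝ x e|} ≤ μ.real {x | η < ‖x‖} := by
    refine measureReal_mono fun x (hx : η < |inner ℝ x e|) => show η < ‖x‖ from hx.trans_le ?_
    simpa [he] using abs_real_inner_le_norm x e
  have hk : 0 ≤ 2 * (2 * (1 + Real.cos η)) := by linarith [Real.neg_one_le_cos η]
  calc 2 * (1 + Real.cos η) * (1 - Real.exp (-κ))
      = ∫ x, 2 * (1 + Real.cos η) * (1 - Real.cos (1 * inner ℝ x e)) ∂μ := by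
        rw [integral_const_mul, h1]
    _ ≤ ∫ x, ((1 - Real.cos (2 * inner ℝ x e)) +
          2 * (2 * (1 + Real.cos η)) * {x : E | η < |inner ℝ x e|}.indicator 1 x) ∂μ := by
        refine integral_mono ((hcos' 1).const_mul _) ((hcos' 2).add hSi) fun x => ?_
        simpa [indicator] using mul_one_sub_cos_le (y := inner ℝ x e) hη
    _ = (1 - Real.exp (-(κ * 2 ^ α))) +
          2 * (2 * (1 + Real.cos η)) * μ.real {x | η < |inner ℝ x e|} := by
        rw [integral_add (hcos' 2) hSi, hφ 2 zero_le_two,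
          integral_const_mul, integral_indicator_one hS]
    _ ≤ _ := by gcongr

theorem exists_mul_le_measureReal_norm_gt [Nontrivial E] {α : ℝ} (hα : α < 2) :
    ∃ η q κ₀ : ℝ, 0 < η ∧ 0 < q ∧ 0 < κ₀ ∧ ∀ κ, 0 ≤ κ → κ ≤ κ₀ →
      ∀ (μ : Measure E) [IsProbabilityMeasure μ],
        (∀ h, charFun μ h = (Real.exp (-(κ * ‖h‖ ^ α)) : ℂ)) → q * κ ≤ μ.real {x | η < ‖x‖} := by
  obtain ⟨e, he⟩ := exists_norm_eq E zero_le_one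
  have h4 : (2 : ℝ) ^ α < 4 := by
    calc (2 : ℝ) ^ α < 2 ^ (2 : ℝ) := Real.rpow_lt_rpow_of_exponent_lt one_lt_two hα
      _ = 4 := by norm_num
  have hcont : ∀ᶠ η in 𝓝[>] (0 : ℝ), (2 : ℝ) ^ α < 2 * (1 + Real.cos η) := by
    have : Tendsto (fun η => 2 * (1 + Real.cos η)) (𝓝[>] 0) (𝓝 (2 * (1 + Real.cos 0))) :=
      ((by fun_prop : Continuous fun η => 2 * (1 + Real.cos η)).tendsto 0).mono_left
        nhdsWithin_le_nhds
    refine this.eventually_const_lt ?_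
    norm_num
    exact h4
  obtain ⟨η, hk, hη0, hηpi⟩ := (hcont.and (Ioc_mem_nhdsGT Real.pi_pos)).exists
  set k := 2 * (1 + Real.cos η) with hkdef
  have h2 : (0 : ℝ) < 2 ^ α := by positivity
  have hk4 : k ≤ 4 := by linarith [Real.cos_le_one η]
  refine ⟨η, (k - 2 ^ α) / (4 * k), (k - 2 ^ α) / 8, hη0, ?_, by linarith, ?_⟩
  · have : 0 < k - 2 ^ α := by linarith
    have : 0 < k := by linarith
    positivity
  · intro κ hκ hκ₀ μ _ hμ
    have h := le_measureReal_norm_gt_of_charFun_eq hμ he hηpi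
    rw [← hkdef] at h
    have hk0 : 0 < k := by linarith
    have e1 : Real.exp (-κ) ≤ 1 - κ + κ ^ 2 := by
      rw [Real.exp_neg, inv_le_iff_one_le_mul₀ (Real.exp_pos _)]
      nlinarith [Real.add_one_le_exp κ, sq_nonneg (κ - 1 / 2), pow_nonneg hκ 3]
    have e2 := Real.add_one_le_exp (-(κ * 2 ^ α))
    rw [div_mul_eq_mul_div, div_le_iff₀ (by positivity)]
    have e3 : k * (κ - κ ^ 2) ≤ k * (1 - Real.exp (-κ)) :=
      mul_le_mul_of_nonneg_left (by linarith) hk0.le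
    have e4 : k * κ ^ 2 ≤ (k - 2 ^ α) / 2 * κ := by
      have : k * κ ≤ (k - 2 ^ α) / 2 := by nlinarith
      nlinarith
    nlinarith

end

section

variable {Ω E : Type*} [MeasurableSpace Ω] [NormedAddCommGroup E] [MeasurableSpace E]
  [BorelSpace E] {P : Measure Ω} {T : ℝ} {L : ℝ → Ω → E}

theorem IsLevyProcessOn.measure_forall_norm_le [IsProbabilityMeasure P]
    (hL : IsLevyProcessOn P T L) (hT : 0 ≤ T) (η : ℝ) (n : ℕ) :
    P {ω | ∀ i ∈ Finset.range (n + 1), ‖L ((TimePartition.uniform hT n).p (i + 1)) ω -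
      L ((TimePartition.uniform hT n).p i) ω‖ ≤ η} =
      P {ω | ‖L (T / (n + 1)) ω‖ ≤ η} ^ (n + 1) := by
  set π := TimePartition.uniform hT n with hπ
  have hp : ∀ i, π.p i ∈ Icc 0 T := fun i =>
    ⟨π.first ▸ π.mono i.zero_le, min_le_left _ _⟩
  have hind := hL.indep.nat (t := fun i => ⟨π.p i, hp i⟩) fun i j hij => π.mono hij
  have hB : MeasurableSet {x : E | ‖x‖ ≤ η} := measurableSet_le measurable_norm measurable_const
  have h := hind.measure_inter_preimage_eq_mul (Finset.range (n + 1))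
    (sets := fun _ => {x : E | ‖x‖ ≤ η}) fun _ _ => hB
  have hset : {ω | ∀ i ∈ Finset.range (n + 1), ‖L (π.p (i + 1)) ω - L (π.p i) ω‖ ≤ η} =
      ⋂ i ∈ Finset.range (n + 1),
        (fun ω => L (π.p (i + 1)) ω - L (π.p i) ω) ⁻¹' {x : E | ‖x‖ ≤ η} := by
    ext ω
    simp
  rw [hset, h, Finset.prod_congr rfl (g := fun _ => P {ω | ‖L (T / (n + 1)) ω‖ ≤ η}),
    Finset.prod_const, Finset.card_range]
  intro i hi
  have := (hL.stationary (π.p i) (π.p (i + 1)) (hp i).1 (π.mono i.le_succ)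
    (hp (i + 1)).2).measure_mem_eq hB
  rw [TimePartition.uniform_sub hT (Finset.mem_range.1 hi)] at this
  exact this

end

section

variable {Ω E : Type*} [MeasurableSpace Ω] [NormedAddCommGroup E] [InnerProductSpace ℝ E]
  [MeasurableSpace E] [BorelSpace E] [SecondCountableTopology E] {P : Measure Ω} {T α : ℝ}
  {L : ℝ → Ω → E}

/-- With a probability bounded below, some increment over a fine uniform grid is large. -/
theorem IsIsotropicStableOn.exists_measure_le [Nontrivial E] [IsProbabilityMeasure P] (hT : 0 < T)
    (hα : α < 2) (hL : IsIsotropicStableOn P T α L) :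
    ∃ η ρ : ℝ, 0 < η ∧ 0 < ρ ∧ ∀ᶠ n in atTop, ENNReal.ofReal ρ ≤
      P {ω | ∃ i ∈ Finset.range (n + 1), η < ‖L ((TimePartition.uniform hT.le n).p (i + 1)) ω -
        L ((TimePartition.uniform hT.le n).p i) ω‖} := by
  obtain ⟨η, q, κ₀, hη, hq, hκ₀, h⟩ := exists_mul_le_measureReal_norm_gt (E := E) hα
  obtain ⟨c, hc, hφ⟩ := hL.charFun_eq
  refine ⟨η, 1 - Real.exp (-(q * (c * T))), hη, ?_, ?_⟩
  · rw [sub_pos, Real.exp_lt_one_iff]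
    have : 0 < q * (c * T) := by positivity
    linarith
  have hlim : Tendsto (fun n : ℕ => c * (T / (n + 1))) atTop (𝓝 0) := by
    simpa [div_eq_mul_inv, mul_assoc] using
      (tendsto_one_div_add_atTop_nhds_zero_nat (𝕜 := ℝ)).const_mul (c * T)
  filter_upwards [hlim.eventually_le_const hκ₀] with n hn
  have hu : T / (n + 1) ∈ Icc 0 T :=
    ⟨by positivity, div_le_self hT.le (by linarith [n.cast_nonneg (α := ℝ)])⟩
  have hm := hL.aemeasurable _ hu
  have := Measure.isProbabilityMeasure_map hm
  have hB : MeasurableSet {x : E | η < ‖x‖} := measurableSet_lt measurable_const measurable_norm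
  have h1 := h (c * (T / (n + 1))) (by positivity) hn (P.map (L (T / (n + 1)))) (hφ _ hu)
  rw [map_measureReal_apply_of_aemeasurable hm hB] at h1
  have hnull : NullMeasurableSet {ω | η < ‖L (T / (n + 1)) ω‖} P := hm.nullMeasurableSet_preimage hB
  have h2 : P.real {ω | ‖L (T / (n + 1)) ω‖ ≤ η} ≤ Real.exp (-(q * (c * (T / (n + 1))))) := by
    have hcompl : {ω | ‖L (T / (n + 1)) ω‖ ≤ η} = {ω | η < ‖L (T / (n + 1)) ω‖}ᶜ := by
      ext ω
      simp
    rw [hcompl, probReal_compl_eq_one_sub₀ hnull]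
    have := Real.add_one_le_exp (-(q * (c * (T / (n + 1)))))
    simp only [preimage_ofPred_eq] at h1
    linarith
  have h3 := hL.measure_forall_norm_le hT.le η n
  set A := {ω | ∃ i ∈ Finset.range (n + 1), η < ‖L ((TimePartition.uniform hT.le n).p (i + 1)) ω -
        L ((TimePartition.uniform hT.le n).p i) ω‖} with hA
  have hAc : {ω | ∀ i ∈ Finset.range (n + 1), ‖L ((TimePartition.uniform hT.le n).p (i + 1)) ω -
      L ((TimePartition.uniform hT.le n).p i) ω‖ ≤ η} = Aᶜ := by
    ext ω
    simp [hA]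
  rw [hAc] at h3
  have h4 : P.real Aᶜ ≤ Real.exp (-(q * (c * T))) := by
    rw [measureReal_def, h3, ENNReal.toReal_pow, ← measureReal_def]
    refine (pow_le_pow_left₀ measureReal_nonneg h2 _).trans_eq ?_
    rw [← Real.exp_nat_mul]
    congr 1
    push_cast
    field_simp
  have h5 : 1 ≤ P.real A + P.real Aᶜ := by
    rw [← probReal_univ (μ := P), ← union_compl_self A]
    exact measureReal_union_le _ _
  rw [← ofReal_measureReal]
  exact ENNReal.ofReal_le_ofReal (by linarith)

end

theorem ofReal_le_iSup_enorm_of_lt_norm_sub {E : Type*} [NormedAddCommGroup E] [NormedSpace ℝ E]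
    {T a η s t : ℝ} {x z : ℝ → E} (ha : 0 < a)
    (hz : IsCadlagOn T z) (h : ∀ t ∈ Icc 0 T, z t = -(a • ∫ s in (0 : ℝ)..t, z s) + x t)
    (hs : 0 ≤ s) (hst : s ≤ t) (ht : t ≤ T) (hats : a * (t - s) ≤ 1) (hx : η < ‖x t - x s‖) :
    ENNReal.ofReal (η / 3) ≤ ⨆ t ∈ Icc 0 T, ‖z t‖ₑ := by
  by_contra! hlt
  have hs' : s ∈ Icc 0 T := ⟨hs, hst.trans ht⟩
  have ht' : t ∈ Icc 0 T := ⟨hs.trans hst, ht⟩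
  have hη : 0 < η / 3 := ENNReal.ofReal_pos.1 (bot_le.trans_lt hlt)
  have hb : ∀ r ∈ Icc 0 T, ‖z r‖ ≤ η / 3 := fun r hr => by
    have := (le_iSup₂ (f := fun t (_ : t ∈ Icc 0 T) => ‖z t‖ₑ) r hr).trans hlt.le
    rwa [← ofReal_norm, ENNReal.ofReal_le_ofReal_iff hη.le] at this
  have hI : ‖∫ r in s..t, z r‖ ≤ η / 3 * |t - s| :=
    intervalIntegral.norm_integral_le_of_norm_le_const fun r hr => by
      rw [uIoc_of_le hst] at hr
      exact hb r ⟨hs.trans hr.1.le, hr.2.trans ht⟩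
  rw [abs_of_nonneg (by linarith)] at hI
  have heq : x t - x s = z t - z s + a • ∫ r in s..t, z r := by
    rw [h t ht', h s hs', ← intervalIntegral.integral_interval_sub_left
      (hz.intervalIntegrable ht') (hz.intervalIntegrable hs'), smul_sub]
    abel
  have h1 : ‖a • ∫ r in s..t, z r‖ ≤ η / 3 := by
    rw [norm_smul, Real.norm_of_nonneg ha.le]
    nlinarith
  have h2 := norm_add_le (z t - z s) (a • ∫ r in s..t, z r)
  have h3 := norm_sub_le (z t) (z s)
  rw [heq] at hx
  linarith [hb t ht', hb s hs']

theorem IsIsotropicStableOn.exists_le_lintegral_iSup {Ω E : Type*} [MeasurableSpace Ω]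
    [NormedAddCommGroup E] [InnerProductSpace ℝ E] [MeasurableSpace E] [BorelSpace E]
    [SecondCountableTopology E] [Nontrivial E] {P : Measure Ω} [IsProbabilityMeasure P] {T α : ℝ}
    {L : ℝ → Ω → E} (hT : 0 < T) (hα : α < 2) (hL : IsIsotropicStableOn P T α L) :
    ∃ m : ℝ≥0∞, 0 < m ∧ ∀ ε, 0 < ε → ∀ Z : ℝ → Ω → E, SolvesOU P T ε L Z →
      m ≤ ∫⁻ ω, ⨆ t ∈ Icc 0 T, ‖Z t ω‖ₑ ∂P := by
  obtain ⟨η, ρ, hη, hρ, h⟩ := hL.exists_measure_le hT hα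
  refine ⟨ENNReal.ofReal (η / 3) * ENNReal.ofReal ρ, by
    rw [← ENNReal.ofReal_mul (by positivity)]; exact ENNReal.ofReal_pos.2 (by positivity),
    fun ε hε Z hZ => ?_⟩
  have hlim : Tendsto (fun n : ℕ => ε⁻¹ * (T / (n + 1))) atTop (𝓝 0) := by
    simpa [div_eq_mul_inv, mul_assoc] using
      (tendsto_one_div_add_atTop_nhds_zero_nat (𝕜 := ℝ)).const_mul (ε⁻¹ * T)
  obtain ⟨n, hn, hεn⟩ := (h.and (hlim.eventually_le_const zero_lt_one)).exists
  set π := TimePartition.uniform hT.le n with hπ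
  have hmem : ∀ j ≤ n + 1, π.p j ∈ Icc 0 T := fun j hj => π.mem_Icc hj
  set A := {ω | ∃ i ∈ Finset.range (n + 1), η < ‖L (π.p (i + 1)) ω - L (π.p i) ω‖} with hA
  have hAm : NullMeasurableSet A P := by
    have : A = ⋃ i ∈ Finset.range (n + 1), {ω | η < ‖L (π.p (i + 1)) ω - L (π.p i) ω‖} := by
      ext ω
      simp [hA]
    rw [this]
    refine Finset.nullMeasurableSet_biUnion _ fun i hi => ?_
    have hi' := Finset.mem_range.1 hi
    exact nullMeasurableSet_lt aemeasurable_const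
      ((hL.aemeasurable _ (hmem _ hi')).sub (hL.aemeasurable _ (hmem _ hi'.le))).norm
  calc ENNReal.ofReal (η / 3) * ENNReal.ofReal ρ ≤ ENNReal.ofReal (η / 3) * P A := by gcongr
    _ = ∫⁻ ω, A.indicator (fun _ => ENNReal.ofReal (η / 3)) ω ∂P :=
        (lintegral_indicator_const₀ hAm _).symm
    _ ≤ _ := by
        refine lintegral_mono_ae ?_
        filter_upwards [hZ.cadlag, hZ.eq] with ω hc heq
        by_cases hω : ω ∈ A
        · rw [indicator_of_mem hω]
          obtain ⟨i, hi, hlt⟩ := hω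
          have hi' := Finset.mem_range.1 hi
          refine ofReal_le_iSup_enorm_of_lt_norm_sub (x := fun t => L t ω - L 0 ω)
            (inv_pos.2 hε) hc heq (hmem i hi'.le).1 (π.mono i.le_succ) (hmem (i + 1) hi').2 ?_
            (by simpa using hlt)
          rwa [hπ, TimePartition.uniform_sub hT.le hi']
        · rw [indicator_of_notMem hω]
          exact bot_le

theorem mainTheorem2 {Ω : Type*} [MeasurableSpace Ω] (P : Measure Ω) [IsProbabilityMeasure P]
    (d : ℕ) (hd : 1 ≤ d) (T : ℝ) (hT : 0 < T) (α : ℝ) (hα₁ : 1 < α) (hα₂ : α < 2)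
    (L : ℝ → Ω → EuclideanSpace ℝ (Fin d)) (hL : IsIsotropicStableOn P T α L) :
    (∀ ε : ℝ, 0 < ε → ∃ Z : ℝ → Ω → EuclideanSpace ℝ (Fin d), IsOUIntegral P T ε L Z) ∧
    (∀ ε : ℝ, 0 < ε → ∀ Z : ℝ → Ω → EuclideanSpace ℝ (Fin d),
      IsOUIntegral P T ε L Z ↔ SolvesOU P T ε L Z) ∧
    ∀ Z : ℝ → ℝ → Ω → EuclideanSpace ℝ (Fin d), (∀ ε : ℝ, 0 < ε → IsOUIntegral P T ε L (Z ε)) →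
      0 < limsup (fun ε : ℝ => ∫⁻ ω, ⨆ t ∈ Icc 0 T, ‖Z ε t ω‖ₑ ∂P) (𝓝[>] 0) ∧
      ∀ t ∈ Icc 0 T, Tendsto (fun ε : ℝ => ∫⁻ ω, ‖Z ε t ω‖ₑ ∂P) (𝓝[>] 0) (𝓝 0) := by
  have hsol : ∀ ε : ℝ, 0 < ε → ∀ Z : ℝ → Ω → EuclideanSpace ℝ (Fin d),
      IsOUIntegral P T ε L Z ↔ SolvesOU P T ε L Z := fun ε _ Z => hL.isOUIntegral_iff_solvesOU hT.le
  refine ⟨fun ε _ => ⟨_, hL.isOUIntegral_ouPath hT.le ε⟩, hsol, fun Z hZ => ⟨?_, fun t ht => ?_⟩⟩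
  · have : Nonempty (Fin d) := ⟨⟨0, hd⟩⟩
    obtain ⟨m, hm, h⟩ := hL.exists_le_lintegral_iSup hT hα₂
    refine hm.trans_le (le_limsup_of_frequently_le (Eventually.frequently ?_))
    filter_upwards [self_mem_nhdsWithin] with ε hε
    exact h ε hε _ ((hsol ε hε _).1 (hZ ε hε))
  · have hbound : ∀ δ : ℝ, 0 < δ → ∃ M, ∀ ε : ℝ, 0 < ε →
        ∫⁻ ω, ‖Z ε t ω‖ₑ ∂P ≤ ENNReal.ofReal (δ + M * ε) := fun δ hδ => by
      obtain ⟨M, hM, h⟩ := hL.lintegral_enorm_le hα₁ hδ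
      refine ⟨M, fun ε hε => ?_⟩
      have := TimePartition.comap_mesh_neBot ht.1
      have heq := tendstoInMeasure_ae_unique ((hZ ε hε).eq_integral t ht).2
        (hL.isStochasticIntegral_ouPath ε⁻¹ ht).2
      rw [lintegral_congr_ae (heq.mono fun ω hω => by rw [hω])]
      simpa using hL.lintegral_enorm_ouPath_le hδ.le hM h (inv_pos.2 hε) ht
    refine ENNReal.tendsto_nhds_zero.2 fun δ hδ => ?_
    obtain ⟨r, hr0, hrδ⟩ := ENNReal.lt_iff_exists_real_btwn.1 hδ
    have hr : 0 < r := ENNReal.ofReal_pos.1 hrδ.1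
    obtain ⟨M, hM⟩ := hbound (r / 2) (half_pos hr)
    have hlim : Tendsto (fun ε : ℝ => r / 2 + M * ε) (𝓝[>] 0) (𝓝 (r / 2 + M * 0)) :=
      ((by fun_prop : Continuous fun ε : ℝ => r / 2 + M * ε).tendsto 0).mono_left
        nhdsWithin_le_nhds
    filter_upwards [self_mem_nhdsWithin, hlim.eventually_le_const (u := r) (by simpa using hr)] with ε hε h
    exact (hM ε hε).trans ((ENNReal.ofReal_le_ofReal h).trans hrδ.2.le)
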